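/- Let $p\ge 0$, $w\ge 1$, $n\ge 1$ be integers, let $a_p,z_1,\ldots,z_w\in\mathbb{C}$ with $a_p\ne 0$, and let $a(t)=\sum_{k=p-w}^{p}a_kt^k=a_p\,t^{p-w}\prod_{j=1}^{w}(t-z_j)$, with $a_k=0$ for $k>p$ and for $k<p-w$. Let $T_n(a)=[a_{j-k}]_{j,k=1}^{n}$ be the corresponding banded Toeplitz matrix. Let $h_k$ be the complete homogeneous symmetric polynomial of degree $k$ in $w$ variables (so $h_0=1$), with $h_k=0$ for $k<0$. For partitions $\lambda,\mu$ (weakly decreasing tuples of nonnegative integers, extended by zeros when needed) let $s_{\lambda/\mu}=\det[h_{\lambda_j-\mu_k-j+k}]_{j,k=1}^{\ell(\lambda)}$ be the skew Schur polynomial if $\mu_j\le\lambda_j$ for all $j$, and $s_{\lambda/\mu}=0$ otherwise, where $\ell(\lambda)$ is the number of entries of the tuple $\lambda$; let $s_\lambda=s_{\lambda/()}$ be the Schur polynomial. In subscripts, a comma denotes concatenation of tuples and $m^q$ denotes $m$ repeated $q$ times. All these polynomials are evaluated at $(z_1,\ldots,z_w)$. Then for all $r,s\in\{1,\ldots,n\}$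 the entry $(r,s)$ of the adjugate matrix of $T_n(a)$ satisfies $$\operatorname{adj}(T_n(a))_{r,s}=(-1)^{p(n-1)}\,a_p^{n-1}\,s_{((n-1)^p,\,s-1)/(r-1)},$$ $$\operatorname{adj}(T_n(a))_{r,s}=(-1)^{p(n-1)}\,a_p^{n-1}\,s_{((n-1)^p,\,n-r)/(n-s)},$$ $$\operatorname{adj}(T_n(a))_{r,s}=(-1)^{p(n-1)}\,a_p^{n-1}\sum_{k=\max(0,\,s-r)}^{\min(n-r,\,s-1)}s_{((n-1)^{p-1},\,n+s-r-1-k,\,k)}\qquad\text{if } p\ge 1,$$ $$\operatorname{adj}(T_n(a))_{r,s}=(-1)^{pn}\,a_p^{n-1}\left(h_{s-r-p}\,s_{(n^p)}-\sum_{k=0}^{p-1}(-1)^k\,h_{s+k-p}\,s_{(n^{p-k-1},\,(n-1)^k,\,n-r)}\right).$$ -/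

import Mathlib

open scoped LaurentPolynomial

noncomputable section

namespace BandedToeplitz

/-- The complete homogeneous symmetric polynomial `h_k` in `w` variables, indexed by all integers:
it is zero for `k < 0`. -/
def completeHomogeneous (w : ℕ) (k : ℤ) : MvPolynomial (Fin w) ℂ :=
  if 0 ≤ k then MvPolynomial.hsymm (Fin w) ℂ k.toNat else 0

/-- The `j`-th entry (counted from `0`) of a tuple, extended by zeros. -/
def part (l : List ℕ) (j : ℕ) : ℕ := l.getD j 0

/-- The Jacobi-Trudi matrix `[h_{l_j - m_k - j + k}]` of size `ℓ(l)`; the tuple `m` is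
extended by zeros. -/
def jacobiTrudi (w : ℕ) (l m : List ℕ) :
    Matrix (Fin l.length) (Fin l.length) (MvPolynomial (Fin w) ℂ) :=
  Matrix.of fun j k =>
    completeHomogeneous w ((part l j : ℤ) - (part m k : ℤ) - ((j : ℕ) : ℤ) + ((k : ℕ) : ℤ))

open Classical in
/-- The skew Schur polynomial `s_{l/m}` in `w` variables, for partitions `l`, `m` written as weakly
decreasing tuples: the Jacobi-Trudi determinant if `m ⊆ l`, and zero if `l / m` is not a
skew partition. -/
def skewSchur (w : ℕ) (l m : List ℕ) : MvPolynomial (Fin w) ℂ :=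
  if ∀ j, part m j ≤ part l j then (jacobiTrudi w l m).det else 0

/-- The Schur polynomial `s_l` in `w` variables. -/
def schur (w : ℕ) (l : List ℕ) : MvPolynomial (Fin w) ℂ := skewSchur w l []

/-- The Toeplitz matrix `T_n(a) = [a_{j-k}]` generated by a Laurent polynomial `a`. -/
def toeplitz (n : ℕ) (a : ℂ[T;T⁻¹]) : Matrix (Fin n) (Fin n) ℂ :=
  Matrix.of fun j k => a.coeff (((j : ℕ) : ℤ) - ((k : ℕ) : ℤ))

end BandedToeplitz

end

/-!
Write `a(t) = a_p t^p f(1/t)` with `f = ∏ (1 - z_j X)`, and let `g = ∑ h_k X^k`, so that `f g = 1`.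
Up to the factor `a_p`, the matrix `T_n(a)` is a corner of the upper triangular Toeplitz matrix of
`f` of size `n + p`, whose inverse is the upper triangular Toeplitz matrix of `g`. Jacobi's
complementary minor identity then turns each cofactor of `T_n(a)` into a minor of size `p + 1` of
the latter matrix, that is, into the Jacobi-Trudi determinant of the second formula.

Transposing that determinant along its antidiagonal gives the first formula. Laplace expansion along
the first column, the only one which feels the inner partition `(n - s)`, gives the fourth. The
third is Pieri's rule `s_{λ/(m)} = ∑ s_μ`, where `μ` ranges over the partitions obtained from `λ` by
removing a horizontal strip of size `m`.
-/

namespace BandedToeplitz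

open Matrix
open scoped PowerSeries LaurentSeries

variable {R : Type*} [CommRing R]

section Toeplitz

/-- The Toeplitz matrix `[a_{j-k}]` of a two-sided sequence, over an arbitrary ring. -/
def toeplitzMatrix (n : ℕ) (a : ℤ → R) : Matrix (Fin n) (Fin n) R :=
  Matrix.of fun j k => a ((j : ℤ) - (k : ℤ))

/-- The upper triangular Toeplitz matrix `[f_{k-j}]` of a power series, whose coefficients are
extended by zero to negative indices by passing to Laurent series. -/
noncomputable def upperToeplitz (n : ℕ) (f : R⟦X⟧) : Matrix (Fin n) (Fin n) R :=
  toeplitzMatrix n fun k => (f : R⸨X⸩).coeff (-k)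

lemma upperToeplitz_apply (n : ℕ) (f : R⟦X⟧) (j k : Fin n) :
    upperToeplitz n f j k = (f : R⸨X⸩).coeff ((k : ℤ) - (j : ℤ)) := by
  simp [upperToeplitz, toeplitzMatrix]

lemma coeff_coe_of_neg (f : R⟦X⟧) {k : ℤ} (hk : k < 0) : (f : R⸨X⸩).coeff k = 0 := by
  rw [PowerSeries.coeff_coe, if_pos hk]

lemma coeff_coe_natCast_sub_natCast (f : R⟦X⟧) {j k : ℕ} (hjk : j ≤ k) :
    (f : R⸨X⸩).coeff ((k : ℤ) - (j : ℤ)) = PowerSeries.coeff (k - j) f := by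
  rw [← Nat.cast_sub hjk, LaurentSeries.coeff_coe_powerSeries]

lemma upperToeplitz_one (n : ℕ) : upperToeplitz n (1 : R⟦X⟧) = 1 := by
  ext j k
  simp [upperToeplitz_apply, HahnSeries.coeff_one, Matrix.one_apply, sub_eq_zero, Fin.ext_iff,
    eq_comm]

lemma upperToeplitz_mul (n : ℕ) (f g : R⟦X⟧) :
    upperToeplitz n (f * g) = upperToeplitz n f * upperToeplitz n g := by
  ext j k
  simp only [Matrix.mul_apply, upperToeplitz_apply]
  rw [Fin.sum_univ_eq_sum_range (fun l : ℕ => (f : R⸨X⸩).coeff ((l : ℤ) - (j : ℤ)) *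
    (g : R⸨X⸩).coeff ((k : ℤ) - (l : ℤ)))]
  have support_subset : Finset.Ico (j : ℕ) (k + 1) ⊆ Finset.range n := fun l hl => by
    have := k.2
    simp only [Finset.mem_Ico, Finset.mem_range] at *
    omega
  rw [← Finset.sum_subset support_subset fun l _ hl => ?_]
  · rcases le_or_gt (j : ℕ) k with hjk | hkj
    · rw [coeff_coe_natCast_sub_natCast _ hjk, PowerSeries.coeff_mul,
        Finset.Nat.sum_antidiagonal_eq_sum_range_succ fun s t =>
          PowerSeries.coeff s f * PowerSeries.coeff t g,
        Finset.sum_Ico_eq_sum_range, Nat.succ_eq_add_one, Nat.sub_add_comm hjk]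
      refine Finset.sum_congr rfl fun t ht => ?_
      have := Finset.mem_range.1 ht
      rw [coeff_coe_natCast_sub_natCast _ (by omega), coeff_coe_natCast_sub_natCast _ (by omega),
        Nat.add_sub_cancel_left, Nat.sub_add_eq]
    · rw [coeff_coe_of_neg _ (by omega), Finset.Ico_eq_empty (by omega), Finset.sum_empty]
  · rcases lt_or_ge l (j : ℕ) with hlj | hjl
    · rw [coeff_coe_of_neg f (by omega), zero_mul]
    · rw [coeff_coe_of_neg g (by simp only [Finset.mem_Ico] at hl; omega), mul_zero]

lemma det_upperToeplitz (n : ℕ) (f : R⟦X⟧) :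
    (upperToeplitz n f).det = PowerSeries.constantCoeff f ^ n := by
  rw [Matrix.det_of_isUpperTriangular fun j k (hkj : k < j) => ?_]
  · simp [upperToeplitz_apply, PowerSeries.coeff_coe]
  · rw [upperToeplitz_apply, coeff_coe_of_neg _ (by omega)]

end Toeplitz

section Cofactors

lemma cramer_apply_eq_neg_det_fromBlocks {m : Type*} [Fintype m] [DecidableEq m]
    (A : Matrix m m R) (u : m → R) (i : m) :
    A.cramer u i = -(Matrix.fromBlocks A (Matrix.replicateCol (Fin 1) u)
      (Matrix.replicateRow (Fin 1) (Pi.single i 1)) 0).det := by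
  have swapped : (Matrix.fromBlocks A (Matrix.replicateCol (Fin 1) u)
      (Matrix.replicateRow (Fin 1) (Pi.single i 1)) 0).submatrix id
        (Equiv.swap (Sum.inl i) (Sum.inr 0)) =
      Matrix.fromBlocks (A.updateCol i u) (Matrix.replicateCol (Fin 1) (A.col i)) 0 1 := by
    ext (α | α) (β | β)
    · rcases eq_or_ne β i with rfl | hβ
      · simp
      · simp [Equiv.swap_apply_of_ne_of_ne, hβ]
    · simp [Fin.eq_zero β, Matrix.col]
    · rcases eq_or_ne β i with rfl | hβ
      · simp
      · simp [Equiv.swap_apply_of_ne_of_ne, hβ]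
    · simp [Fin.eq_zero β, Fin.eq_zero α]
  have det_swapped := congrArg Matrix.det swapped
  rw [Matrix.det_permute', Equiv.Perm.sign_swap Sum.inl_ne_inr, Matrix.det_fromBlocks_zero₂₁,
    Matrix.det_one, mul_one] at det_swapped
  rw [Matrix.cramer_apply, ← det_swapped]
  simp

lemma adjugate_apply_eq_cramer {m : Type*} [Fintype m] [DecidableEq m] (A : Matrix m m R)
    (i j : m) : A.adjugate i j = A.cramer (Pi.single j 1) i := by
  simp [Matrix.cramer_eq_adjugate_mulVec]

lemma fromBlocks_toBlocks_mul_of_mul_eq_one {m q ι : Type*} [Fintype m] [DecidableEq m]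
    [Fintype q] [DecidableEq q] [Fintype ι] [DecidableEq ι] {M M' : Matrix (m ⊕ q) (m ⊕ q) R}
    (hM : M * M' = 1) (U : Matrix m ι R) (V : Matrix ι m R) :
    fromBlocks M.toBlocks₁₁ (fromCols M.toBlocks₁₂ 0) (fromRows M.toBlocks₂₁ 0)
        (fromBlocks M.toBlocks₂₂ 0 0 (1 : Matrix ι ι R)) *
      fromBlocks 1 (fromCols M'.toBlocks₁₂ (M'.toBlocks₁₁ * U)) (fromRows 0 V)
        (fromBlocks M'.toBlocks₂₂ (M'.toBlocks₂₁ * U) 0 0) =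
      fromBlocks M.toBlocks₁₁ (fromCols 0 U) (fromRows M.toBlocks₂₁ V) (fromBlocks 1 0 0 0) := by
  have blocks : M.toBlocks₁₁ * M'.toBlocks₁₁ + M.toBlocks₁₂ * M'.toBlocks₂₁ = 1 ∧
      M.toBlocks₁₁ * M'.toBlocks₁₂ + M.toBlocks₁₂ * M'.toBlocks₂₂ = 0 ∧
      M.toBlocks₂₁ * M'.toBlocks₁₁ + M.toBlocks₂₂ * M'.toBlocks₂₁ = 0 ∧
      M.toBlocks₂₁ * M'.toBlocks₁₂ + M.toBlocks₂₂ * M'.toBlocks₂₂ = 1 := by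
    rw [← fromBlocks_inj, ← fromBlocks_multiply, fromBlocks_toBlocks, fromBlocks_toBlocks, hM,
      fromBlocks_one]
  obtain ⟨h₁₁, h₁₂, h₂₁, h₂₂⟩ := blocks
  simp only [fromBlocks_multiply, fromCols_mul_fromRows, mul_fromCols, fromRows_mul,
    fromCols_mul_fromBlocks, fromBlocks_mul_fromRows, ← Matrix.mul_assoc]
  rw [fromBlocks_inj]
  refine ⟨by simp, ?_, ?_, ?_⟩
  · ext a (b | b) <;> simp only [Matrix.add_apply, fromCols_apply_inl, fromCols_apply_inr] <;>
      simp [← Matrix.add_apply, ← Matrix.add_mul, h₁₁, h₁₂]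
  · ext (a | a) b <;> simp
  · simp [fromBlocks_add, ← Matrix.add_mul, h₂₁, h₂₂]

lemma det_fromBlocks_toBlocks₁₁_of_mul_eq_one {m q ι : Type*} [Fintype m] [DecidableEq m]
    [Fintype q] [DecidableEq q] [Fintype ι] [DecidableEq ι] {M M' : Matrix (m ⊕ q) (m ⊕ q) R}
    (hM : M * M' = 1) (U : Matrix m ι R) (V : Matrix ι m R) :
    (Matrix.fromBlocks M.toBlocks₁₁ U V 0).det =
      (-1) ^ Fintype.card ι * M.det *
        (Matrix.fromBlocks M'.toBlocks₂₂ (M'.toBlocks₂₁ * U) (V * M'.toBlocks₁₂)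
          (V * M'.toBlocks₁₁ * U)).det := by
  have det_left : (fromBlocks M.toBlocks₁₁ (fromCols M.toBlocks₁₂ 0) (fromRows M.toBlocks₂₁ 0)
      (fromBlocks M.toBlocks₂₂ 0 0 (1 : Matrix ι ι R))).det = M.det := by
    rw [← det_submatrix_equiv_self (Equiv.sumAssoc m q ι), show submatrix _ _ _ =
      fromBlocks M 0 0 1 from ?_, det_fromBlocks_zero₁₂, det_one, mul_one]
    ext ((a | a) | a) ((b | b) | b) <;> rfl
  have det_middle : (fromBlocks 1 (fromCols M'.toBlocks₁₂ (M'.toBlocks₁₁ * U)) (fromRows 0 V)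
        (fromBlocks M'.toBlocks₂₂ (M'.toBlocks₂₁ * U) 0 0)).det =
      (-1) ^ Fintype.card ι * (fromBlocks M'.toBlocks₂₂ (M'.toBlocks₂₁ * U) (V * M'.toBlocks₁₂)
          (V * M'.toBlocks₁₁ * U)).det := by
    rw [det_fromBlocks_one₁₁]
    have scale : fromBlocks M'.toBlocks₂₂ (M'.toBlocks₂₁ * U) 0 0 -
          fromRows 0 V * fromCols M'.toBlocks₁₂ (M'.toBlocks₁₁ * U) =
        fromBlocks 1 0 0 (-1) * fromBlocks M'.toBlocks₂₂ (M'.toBlocks₂₁ * U) (V * M'.toBlocks₁₂)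
          (V * M'.toBlocks₁₁ * U) := by
      ext (a | a) (b | b) <;> simp [fromBlocks_multiply, Matrix.mul_assoc]
    rw [scale, det_mul, det_fromBlocks_zero₁₂, det_one, one_mul, det_neg, det_one, mul_one]
  have det_right : (fromBlocks M.toBlocks₁₁ (fromCols 0 U) (fromRows M.toBlocks₂₁ V)
      (fromBlocks 1 0 0 0)).det = (fromBlocks M.toBlocks₁₁ U V 0).det := by
    rw [← det_submatrix_equiv_self
      ((Equiv.sumAssoc m ι q).trans ((Equiv.refl m).sumCongr (Equiv.sumComm ι q))),
      show submatrix _ _ _ = fromBlocks (fromBlocks M.toBlocks₁₁ U V 0) 0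
        (fromCols M.toBlocks₂₁ 0) 1 from ?_, det_fromBlocks_zero₁₂, det_one, mul_one]
    ext ((a | a) | a) ((b | b) | b) <;> rfl
  rw [← det_right, ← fromBlocks_toBlocks_mul_of_mul_eq_one hM U V, det_mul, det_left, det_middle]
  ring

lemma adjugate_toBlocks₁₁_of_mul_eq_one {m q : Type*} [Fintype m] [DecidableEq m] [Fintype q]
    [DecidableEq q] {M M' : Matrix (m ⊕ q) (m ⊕ q) R} (hM : M * M' = 1) (i j : m) :
    M.toBlocks₁₁.adjugate i j =
      M.det * (M'.submatrix (Sum.elim Sum.inr fun _ : Fin 1 => Sum.inl i)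
        (Sum.elim Sum.inr fun _ : Fin 1 => Sum.inl j)).det := by
  have bordered : M'.submatrix (Sum.elim Sum.inr fun _ : Fin 1 => Sum.inl i)
        (Sum.elim Sum.inr fun _ : Fin 1 => Sum.inl j) =
      fromBlocks M'.toBlocks₂₂ (M'.toBlocks₂₁ * replicateCol (Fin 1) (Pi.single j (1 : R)))
        (replicateRow (Fin 1) (Pi.single i (1 : R)) * M'.toBlocks₁₂)
        (replicateRow (Fin 1) (Pi.single i (1 : R)) * M'.toBlocks₁₁ *
          replicateCol (Fin 1) (Pi.single j (1 : R))) := by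
    ext (a | a) (b | b) <;>
      simp [Matrix.mul_apply, Pi.single_apply, toBlocks₁₁, toBlocks₁₂, toBlocks₂₁,
        toBlocks₂₂]
  rw [adjugate_apply_eq_cramer, cramer_apply_eq_neg_det_fromBlocks,
    det_fromBlocks_toBlocks₁₁_of_mul_eq_one hM, bordered, Fintype.card_fin]
  ring

lemma val_finRotate_pow (n q : ℕ) (i : Fin n) : ((finRotate n ^ q) i : ℕ) = (i + q) % n := by
  induction q with
  | zero => simp [Nat.mod_eq_of_lt i.2]
  | succ q ih =>
    have : NeZero n := ⟨i.pos.ne'⟩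
    rw [pow_succ', Equiv.Perm.mul_apply, finRotate_apply, Fin.val_add, ih, Fin.val_one',
      ← Nat.add_mod, add_assoc]

lemma sign_finRotate_pow (n p : ℕ) :
    Equiv.Perm.sign (finRotate (n + p) ^ p) = (-1) ^ (n * p) := by
  rw [map_pow, sign_finRotate, ← pow_mul]
  obtain _ | p := p
  · simp
  · rw [← add_assoc, Nat.add_sub_cancel, add_mul, pow_add, (Nat.even_mul_succ_self p).neg_one_pow,
      mul_one]

lemma det_submatrix_finRotate_pow (n p : ℕ) (A : Matrix (Fin (n + p)) (Fin (n + p)) R) :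
    (A.submatrix finSumFinEquiv (finSumFinEquiv.trans (finRotate (n + p) ^ p))).det =
      (-1) ^ (n * p) * A.det := by
  have h := Matrix.det_permute' (finRotate (n + p) ^ p) A
  rw [sign_finRotate_pow, ← Matrix.det_submatrix_equiv_self finSumFinEquiv] at h
  simpa using h

lemma val_finRotate_pow_castAdd {n p : ℕ} (i : Fin n) :
    ((finRotate (n + p) ^ p) (Fin.castAdd p i) : ℕ) = i + p := by
  rw [val_finRotate_pow, Fin.val_castAdd, Nat.mod_eq_of_lt (by omega)]

lemma val_finRotate_pow_natAdd {n p : ℕ} (i : Fin p) :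
    ((finRotate (n + p) ^ p) (Fin.natAdd n i) : ℕ) = i := by
  rw [val_finRotate_pow, Fin.val_natAdd, add_right_comm, Nat.add_mod_left,
    Nat.mod_eq_of_lt (by omega)]

end Cofactors

section JacobiTrudi

/-- The Jacobi-Trudi determinant `det [h_{l_j - m_k - j + k}]` of an arbitrary two-sided sequence
`h` and arbitrary integer tuples `l`, `m` of the same length. -/
def jacobiTrudiDet {N : ℕ} (h : ℤ → R) (l m : Fin N → ℤ) : R :=
  (Matrix.of fun j k : Fin N => h (l j - m k - (j : ℤ) + (k : ℤ))).det

lemma jacobiTrudiDet_reflect {N : ℕ} (h : ℤ → R) (l m : Fin N → ℤ) (c : ℤ) :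
    jacobiTrudiDet h l m =
      jacobiTrudiDet h (fun j => c - m j.rev) (fun k => c - l k.rev) := by
  rw [jacobiTrudiDet, jacobiTrudiDet, ← Matrix.det_transpose,
    ← Matrix.det_submatrix_equiv_self Fin.revPerm]
  congr 1
  ext j k
  simp only [submatrix_apply, transpose_apply, of_apply, Fin.revPerm_apply, Fin.val_rev]
  congr 1
  omega

lemma jacobiTrudiDet_succ {N : ℕ} (h : ℤ → R) (l m : Fin (N + 1) → ℤ) :
    jacobiTrudiDet h l m =
      ∑ a : Fin (N + 1), (-1) ^ (a : ℕ) * h (l a - m 0 - a) *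
        jacobiTrudiDet h (fun j => if j.castSucc < a then l j.castSucc + 1 else l j.succ)
          fun k => m k.succ := by
  rw [jacobiTrudiDet, Matrix.det_succ_column_zero]
  refine Finset.sum_congr rfl fun a _ => ?_
  congr 1
  · simp
  · rw [jacobiTrudiDet]
    congr 1
    ext j k
    simp only [submatrix_apply, of_apply]
    rcases lt_or_ge j.castSucc a with hj | hj
    · rw [if_pos hj, Fin.succAbove_of_castSucc_lt _ _ hj]
      congr 1
      push_cast [Fin.val_succ, Fin.val_castSucc]
      ring
    · rw [if_neg hj.not_gt, Fin.succAbove_of_le_castSucc _ _ hj]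
      congr 1
      push_cast [Fin.val_succ]
      ring

open PowerSeries in
lemma adjugate_toeplitzMatrix_coeff {f g : R⟦X⟧} (hf : constantCoeff f = 1) (hfg : f * g = 1)
    (p : ℕ) {n : ℕ} (i j : Fin n) :
    (toeplitzMatrix n fun k => (f : R⸨X⸩).coeff (p - k)).adjugate i j =
      (-1) ^ (n * p + p) * jacobiTrudiDet (g : R⸨X⸩).coeff
        (fun a : Fin (p + 1) => if (a : ℕ) < p then n - 1 else n - 1 - i)
        fun b => if (b : ℕ) = 0 then n - 1 - j else 0 := by
  let e : Fin n ⊕ Fin p ≃ Fin (n + p) := finSumFinEquiv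
  let e' : Fin n ⊕ Fin p ≃ Fin (n + p) := finSumFinEquiv.trans (finRotate (n + p) ^ p)
  have inverse : (upperToeplitz (n + p) f).submatrix e e' *
      (upperToeplitz (n + p) g).submatrix e' e = 1 := by
    rw [Matrix.submatrix_mul_equiv, ← upperToeplitz_mul, hfg, upperToeplitz_one,
      Matrix.submatrix_one_equiv]
  have det_eq : ((upperToeplitz (n + p) f).submatrix e e').det = (-1) ^ (n * p) := by
    rw [det_submatrix_finRotate_pow, det_upperToeplitz, hf, one_pow, mul_one]
  have block : ((upperToeplitz (n + p) f).submatrix e e').toBlocks₁₁ =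
      toeplitzMatrix n fun k => (f : R⸨X⸩).coeff (p - k) := by
    ext a b
    simp only [toeplitzMatrix, toBlocks₁₁, of_apply, submatrix_apply, upperToeplitz_apply, e, e',
      Equiv.trans_apply, finSumFinEquiv_apply_left, val_finRotate_pow_castAdd, Fin.val_castAdd,
      Nat.cast_add]
    congr 1
    ring
  rw [← block, adjugate_toBlocks₁₁_of_mul_eq_one inverse, det_eq, pow_add, mul_assoc,
    jacobiTrudiDet]
  congr 1
  rw [show (-1 : R) ^ p = (-1) ^ (p * 1) by rw [mul_one], ← det_submatrix_finRotate_pow p 1]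
  congr 1
  ext (a | a) (b | b)
  all_goals
    simp only [submatrix_apply, of_apply, Sum.elim_inl, Sum.elim_inr, e, e', upperToeplitz_apply,
      Equiv.trans_apply, finSumFinEquiv_apply_left, finSumFinEquiv_apply_right,
      val_finRotate_pow_castAdd, val_finRotate_pow_natAdd, Fin.val_castAdd, Fin.val_natAdd]
    congr 1
  all_goals simp
  all_goals ring

end JacobiTrudi

section Pieri

open PowerSeries

lemma det_eq_of_forall_row_eq_add_smul_succ {n : ℕ} {A B : Matrix (Fin (n + 1)) (Fin (n + 1)) R}
    (c : Fin n → R) (A_last : ∀ k, A (Fin.last n) k = B (Fin.last n) k)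
    (A_castSucc : ∀ i k, A i.castSucc k = B i.castSucc k + c i * A i.succ k) :
    A.det = B.det := by
  rw [← Matrix.det_submatrix_equiv_self Fin.revPerm A,
    ← Matrix.det_submatrix_equiv_self Fin.revPerm B]
  refine Matrix.det_eq_of_forall_row_eq_smul_add_pred (fun i => c i.rev) (fun k => ?_)
    fun i k => ?_
  · simpa using A_last k.rev
  · simpa [Fin.rev_succ, Fin.rev_castSucc] using A_castSucc i.rev k.rev

variable (h : ℤ → R)

/-- The generating series `∑ h_{a-m} X^m`, in which the exponent of `X` marks the length `m` of the
row removed in Pieri's rule. -/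
noncomputable def shiftSeries (a : ℤ) : R⟦X⟧ := PowerSeries.mk fun m => h (a - m)

lemma shiftSeries_eq_C_add (a : ℤ) :
    shiftSeries h a = C (h a) + X * shiftSeries h (a - 1) := by
  ext m
  cases m with
  | zero => simp [shiftSeries]
  | succ m => simp [shiftSeries, coeff_succ_X_mul, sub_sub, add_comm]

lemma shiftSeries_eq_sum_Icc_add {a b : ℕ} (hba : b ≤ a) (k : ℤ) :
    shiftSeries h (a + k) =
      ∑ μ ∈ Finset.Icc b a, X ^ (a - μ) * C (h (μ + k)) +
        X ^ (a - b + 1) * shiftSeries h (b - 1 + k) := by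
  induction a, hba using Nat.le_induction with
  | base => simpa [add_sub_right_comm] using shiftSeries_eq_C_add h (b + k)
  | succ a hba ih =>
    have shift_sum : ∑ μ ∈ Finset.Icc b a, X ^ (a + 1 - μ) * C (h (μ + k)) =
        X * ∑ μ ∈ Finset.Icc b a, X ^ (a - μ) * C (h (μ + k)) := by
      rw [Finset.mul_sum]
      refine Finset.sum_congr rfl fun μ hμ => ?_
      rw [Nat.sub_add_comm (Finset.mem_Icc.1 hμ).2, pow_succ', mul_assoc]
    rw [shiftSeries_eq_C_add, show ((a + 1 : ℕ) : ℤ) + k - 1 = a + k by push_cast; ring, ih,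
      Finset.sum_Icc_succ_top (by omega), shift_sum, Nat.sub_add_comm hba, Nat.sub_self]
    ring

variable {h} in
lemma shiftSeries_of_neg (hneg : ∀ k < 0, h k = 0) {a : ℤ} (ha : a < 0) :
    shiftSeries h a = 0 := by
  ext m
  simp [shiftSeries, hneg (a - m) (by omega)]

lemma coeff_det_shiftSeries {N : ℕ} (l : Fin (N + 1) → ℤ) (m : ℕ) :
    PowerSeries.coeff m (Matrix.of fun j k : Fin (N + 1) => shiftSeries h (l j - j + k)).det =
      jacobiTrudiDet h l (Pi.single 0 (m : ℤ)) := by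
  let B : Matrix (Fin (N + 1)) (Fin (N + 1)) R⟦X⟧ :=
    Matrix.of fun j => Fin.cons (shiftSeries h (l j - j)) fun k => C (h (l j - j + k.succ))
  have det_eq : (Matrix.of fun j k : Fin (N + 1) => shiftSeries h (l j - j + k)).det = B.det := by
    refine Matrix.det_eq_of_forall_col_eq_smul_add_pred (fun _ => X) (fun j => by simp [B])
      fun j k => ?_
    rw [of_apply, of_apply, shiftSeries_eq_C_add, Fin.val_castSucc, Fin.val_succ, Nat.cast_succ,
      ← add_assoc, add_sub_cancel_right]
    simp [B, add_assoc]
  have minor (j : Fin (N + 1)) : B.submatrix j.succAbove Fin.succ =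
      (C (R := R)).mapMatrix (Matrix.of fun a b : Fin N =>
        h (l (j.succAbove a) - (j.succAbove a : ℕ) + b.succ)) := by
    ext a b : 2
    simp [B]
  rw [det_eq, jacobiTrudiDet, Matrix.det_succ_column_zero, Matrix.det_succ_column_zero, map_sum]
  refine Finset.sum_congr rfl fun j _ => ?_
  rw [minor, ← RingHom.map_det, coeff_mul_C]
  congr 1
  · have sign : (-1 : R⟦X⟧) ^ (j : ℕ) = C ((-1) ^ (j : ℕ)) := by simp
    rw [sign, mul_comm, coeff_mul_C, mul_comm]
    simp [B, shiftSeries, sub_right_comm]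
  · congr 1
    ext a b
    simp

variable {h} in
lemma det_shiftSeries_eq_det_sum (hneg : ∀ k < 0, h k = 0) {N : ℕ} {l : ℕ → ℕ} (hl : Antitone l)
    (hlast : l (N + 1) = 0) :
    (Matrix.of fun j k : Fin (N + 1) => shiftSeries h ((l j : ℤ) - j + k)).det =
      (Matrix.of fun j k : Fin (N + 1) => ∑ μ ∈ Finset.Icc (l (j + 1)) (l j),
        X ^ (l j - μ) * C (h ((μ : ℤ) - j + k))).det := by
  have truncate (j : ℕ) (k : ℤ) : shiftSeries h ((l j : ℤ) - j + k) =
      ∑ μ ∈ Finset.Icc (l (j + 1)) (l j), X ^ (l j - μ) * C (h ((μ : ℤ) - j + k)) +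
        X ^ (l j - l (j + 1) + 1) * shiftSeries h ((l (j + 1) : ℤ) - (j + 1 : ℕ) + k) := by
    have regroup (a : ℤ) : a - j + k = a + (k - j) := by ring
    rw [Nat.cast_succ, show (l (j + 1) : ℤ) - (j + 1) + k = l (j + 1) - 1 + (k - j) by ring]
    simp only [regroup]
    exact shiftSeries_eq_sum_Icc_add h (hl j.le_succ) (k - j)
  refine det_eq_of_forall_row_eq_add_smul_succ (fun j => X ^ (l j - l (j + 1) + 1))
    (fun k => ?_) fun j k => ?_
  · simp only [of_apply, Fin.val_last, truncate N k]
    rw [shiftSeries_of_neg hneg (by omega), mul_zero, add_zero]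
  · simpa using truncate j k

lemma coeff_det_sum_X_pow_mul_C {N : ℕ} (l : Fin N → ℕ) (I : Fin N → Finset ℕ)
    (hI : ∀ j, ∀ μ ∈ I j, μ ≤ l j) (m : ℕ) :
    PowerSeries.coeff m (Matrix.of fun j k : Fin N =>
        ∑ μ ∈ I j, X ^ (l j - μ) * C (h ((μ : ℤ) - j + k))).det =
      ∑ μ ∈ Fintype.piFinset I with ∑ j, μ j + m = ∑ j, l j,
        jacobiTrudiDet h (fun j => (μ j : ℤ)) 0 := by
  have expand : (Matrix.of fun j k : Fin N =>
        ∑ μ ∈ I j, X ^ (l j - μ) * C (h ((μ : ℤ) - j + k))).det =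
      ∑ μ ∈ Fintype.piFinset I,
        X ^ (∑ j, (l j - μ j)) * C (jacobiTrudiDet h (fun j => (μ j : ℤ)) 0) := by
    have rows : (Matrix.of fun j k : Fin N =>
          ∑ μ ∈ I j, X ^ (l j - μ) * C (h ((μ : ℤ) - j + k))) =
        fun j => ∑ μ ∈ I j, fun k : Fin N => X ^ (l j - μ) * C (h ((μ : ℤ) - j + k)) := by
      ext j k : 2
      simp
    rw [rows]
    refine (Matrix.detRowAlternating.toMultilinearMap.map_sum_finset _ I).trans
      (Finset.sum_congr rfl fun μ _ => ?_)
    rw [jacobiTrudiDet, RingHom.map_det, ← Finset.prod_pow_eq_pow_sum]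
    refine Eq.trans ?_ (Matrix.det_mul_column _ _)
    simp
    rfl
  rw [expand, map_sum, Finset.sum_filter]
  refine Finset.sum_congr rfl fun μ hμ => ?_
  have le : ∀ j ∈ Finset.univ, μ j ≤ l j := fun j _ => hI j _ (Fintype.mem_piFinset.1 hμ j)
  have := Finset.sum_le_sum le
  rw [coeff_mul_C, coeff_X_pow, Finset.sum_tsub_distrib _ le, ite_mul, one_mul, zero_mul]
  exact if_congr (by omega) rfl rfl

variable {h} in
lemma jacobiTrudiDet_single_eq_sum (hneg : ∀ k < 0, h k = 0) {N : ℕ} {l : ℕ → ℕ}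
    (hl : Antitone l) (hlast : l (N + 1) = 0) (m : ℕ) :
    jacobiTrudiDet h (fun j : Fin (N + 1) => (l j : ℤ)) (Pi.single 0 (m : ℤ)) =
      ∑ μ ∈ Fintype.piFinset (fun j : Fin (N + 1) => Finset.Icc (l (j + 1)) (l j))
          with ∑ j, μ j + m = ∑ j : Fin (N + 1), l j,
        jacobiTrudiDet h (fun j => (μ j : ℤ)) 0 := by
  rw [← coeff_det_shiftSeries, det_shiftSeries_eq_det_sum hneg hl hlast,
    coeff_det_sum_X_pow_mul_C h (fun j : Fin (N + 1) => l j) _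
      fun j μ hμ => (Finset.mem_Icc.1 hμ).2]

end Pieri

section Lists

lemma part_of_length_le {l : List ℕ} {j : ℕ} (hj : l.length ≤ j) : part l j = 0 :=
  List.getD_eq_default _ _ hj

lemma antitone_part {l : List ℕ} (hl : l.Pairwise (· ≥ ·)) : Antitone (part l) := by
  intro i j hij
  rcases lt_or_ge j l.length with hj | hj
  · rw [part, part, List.getD_eq_getElem _ _ hj, List.getD_eq_getElem _ _ (hij.trans_lt hj)]
    exact hl.sortedGE.getElem_ge_getElem_of_le hij
  · rw [part_of_length_le hj]
    exact zero_le

lemma part_append (l l' : List ℕ) (j : ℕ) :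
    part (l ++ l') j = if j < l.length then part l j else part l' (j - l.length) := by
  split_ifs with hj
  · exact List.getD_append _ _ _ _ hj
  · exact List.getD_append_right _ _ _ _ (not_lt.1 hj)

lemma part_replicate (p x j : ℕ) : part (List.replicate p x) j = if j < p then x else 0 := by
  split_ifs with hj
  · exact List.getD_replicate _ hj
  · exact part_of_length_le (by simpa using hj)

lemma part_replicate_append (p x : ℕ) (l : List ℕ) (j : ℕ) :
    part (List.replicate p x ++ l) j = if j < p then x else part l (j - p) := by
  rw [part_append, List.length_replicate, part_replicate]
  split_ifs <;> rfl

lemma part_cons (x : ℕ) (l : List ℕ) (j : ℕ) :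
    part (x :: l) j = if j = 0 then x else part l (j - 1) := by
  cases j <;> rfl

lemma part_nil (j : ℕ) : part [] j = 0 := rfl

lemma part_map_take_append_drop {l : List ℕ} {a : ℕ} (ha : a ≤ l.length) (j : ℕ) :
    part ((l.take a).map (· + 1) ++ l.drop (a + 1)) j =
      if j < a then part l j + 1 else part l (j + 1) := by
  rw [part_append, List.length_map, List.length_take_of_le ha]
  split_ifs with hj
  · simp [part, List.getD_eq_getElem?_getD, hj, hj.trans_le ha]
  · simp [part, List.getD_eq_getElem?_getD, show a + 1 + (j - a) = j + 1 by omega]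

lemma pairwise_replicate_append_singleton {A B : ℕ} (hBA : B ≤ A) (p : ℕ) :
    (List.replicate p A ++ [B]).Pairwise (· ≥ ·) := by
  simp [List.pairwise_append, hBA]

end Lists

section Schur

/-- The image of the skew Schur polynomial `s_{l/m}` under the specialization `h_k ↦ h k`, as its
Jacobi-Trudi determinant. -/
def specializedSkewSchur (h : ℤ → R) (l m : List ℕ) : R :=
  jacobiTrudiDet h (fun j : Fin l.length => (part l j : ℤ)) fun k => (part m k : ℤ)

lemma specializedSkewSchur_eq (h : ℤ → R) {l : List ℕ} (m : List ℕ) {N : ℕ} (hN : l.length = N) :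
    specializedSkewSchur h l m =
      jacobiTrudiDet h (fun j : Fin N => (part l j : ℤ)) fun k => (part m k : ℤ) := by
  subst hN
  rfl

lemma specializedSkewSchur_rect_reflect (h : ℤ → R) (p : ℕ) {A B m : ℕ} (hB : B ≤ A) (hm : m ≤ A) :
    specializedSkewSchur h (List.replicate p A ++ [B]) [m] =
      specializedSkewSchur h (List.replicate p A ++ [A - m]) [A - B] := by
  rw [specializedSkewSchur_eq h (N := p + 1) _ (by simp),
    specializedSkewSchur_eq h (N := p + 1) _ (by simp), jacobiTrudiDet_reflect h _ _ A]
  simp only [part_replicate_append, part_cons, part_nil, Fin.val_rev]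
  congr 1 <;> ext j <;> split_ifs <;> omega

lemma specializedSkewSchur_singleton_eq_sum {h : ℤ → R} (hneg : ∀ k < 0, h k = 0) {l : List ℕ}
    (hl : l.Pairwise (· ≥ ·)) {N : ℕ} (hN : l.length = N + 1) (m : ℕ) :
    specializedSkewSchur h l [m] =
      ∑ μ ∈ Fintype.piFinset (fun j : Fin (N + 1) => Finset.Icc (part l (j + 1)) (part l j))
          with ∑ j, μ j + m = ∑ j : Fin (N + 1), part l j,
        jacobiTrudiDet h (fun j => (μ j : ℤ)) 0 := by
  rw [← jacobiTrudiDet_single_eq_sum hneg (antitone_part hl) (part_of_length_le hN.le),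
    specializedSkewSchur_eq h _ hN]
  congr 1
  ext k
  simp [part_cons, part_nil, Pi.single_apply]

lemma mem_piFinset_Icc_part_rect {q A B : ℕ} {μ : Fin (q + 2) → ℕ} :
    μ ∈ Fintype.piFinset (fun j : Fin (q + 2) =>
        Finset.Icc (part (List.replicate (q + 1) A ++ [B]) (j + 1))
          (part (List.replicate (q + 1) A ++ [B]) j)) ↔
      (∀ j : Fin q, μ j.castSucc.castSucc = A) ∧
        μ (Fin.last q).castSucc ∈ Finset.Icc B A ∧ μ (Fin.last (q + 1)) ≤ B := by
  simp [Fin.forall_fin_succ', part_replicate_append, part_cons, part_nil, and_assoc,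
    ← le_antisymm_iff, eq_comm]

lemma part_rect_append_pair_eq {q A t : ℕ} {μ : Fin (q + 2) → ℕ}
    (hrect : ∀ j : Fin q, μ j.castSucc.castSucc = A)
    (hsum : μ (Fin.last q).castSucc + μ (Fin.last (q + 1)) = t) :
    (fun j : Fin (q + 2) =>
      part (List.replicate q A ++ [t - μ (Fin.last (q + 1)), μ (Fin.last (q + 1))]) j) = μ := by
  ext j
  induction j using Fin.lastCases with
  | last => simp [part_replicate_append, part_cons]
  | cast j =>
    induction j using Fin.lastCases with
    | last => simp [part_replicate_append, part_cons, ← hsum]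
    | cast j => simp [part_replicate_append, hrect]

lemma mem_filter_piFinset_Icc_part_rect {q A B m : ℕ} {μ : Fin (q + 2) → ℕ} :
    (μ ∈ Finset.filter (fun μ =>
        ∑ j, μ j + m = ∑ j : Fin (q + 2), part (List.replicate (q + 1) A ++ [B]) j)
      (Fintype.piFinset fun j : Fin (q + 2) =>
        Finset.Icc (part (List.replicate (q + 1) A ++ [B]) (j + 1))
          (part (List.replicate (q + 1) A ++ [B]) j))) ↔
    (∀ j : Fin q, μ j.castSucc.castSucc = A) ∧
      B ≤ μ (Fin.last q).castSucc ∧ μ (Fin.last q).castSucc ≤ A ∧ μ (Fin.last (q + 1)) ≤ B ∧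
      μ (Fin.last q).castSucc + μ (Fin.last (q + 1)) + m = A + B := by
  rw [Finset.mem_filter, mem_piFinset_Icc_part_rect, Finset.mem_Icc]
  simp only [and_assoc]
  refine and_congr_right fun hrect => and_congr_right fun _ => and_congr_right fun _ =>
    and_congr_right fun _ => ?_
  have cancel (x y : ℕ) : q * A + x + y + m = q * A + A + B ↔ x + y + m = A + B := by omega
  simpa [Fin.sum_univ_castSucc, hrect, part_replicate_append, part_cons] using cancel _ _

lemma specializedSkewSchur_rect_eq_sum {h : ℤ → R} (hneg : ∀ k < 0, h k = 0) (q : ℕ)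
    {A B m : ℕ} (hB : B ≤ A) (hm : m ≤ A) :
    specializedSkewSchur h (List.replicate (q + 1) A ++ [B]) [m] =
      ∑ k ∈ Finset.Icc (B - m) (min (A - m) B),
        specializedSkewSchur h (List.replicate q A ++ [A + B - m - k, k]) [] := by
  rw [specializedSkewSchur_singleton_eq_sum hneg (pairwise_replicate_append_singleton hB (q + 1))
    (N := q + 1) (by simp)]
  have reconstruct (μ : Fin (q + 2) → ℕ) (hμ : μ ∈ _) :=
    have ⟨hrect, _, _, _, hsum⟩ :=
      (mem_filter_piFinset_Icc_part_rect (A := A) (B := B) (m := m)).1 hμ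
    part_rect_append_pair_eq hrect (Nat.eq_sub_of_add_eq hsum)
  refine Finset.sum_nbij' (fun μ => μ (Fin.last (q + 1)))
    (fun k j => part (List.replicate q A ++ [A + B - m - k, k]) j) (fun μ hμ => ?_)
    (fun k hk => ?_) reconstruct (fun k _ => ?_) fun μ hμ => ?_
  · obtain ⟨-, hBq, hqA, hlast, hsum⟩ := mem_filter_piFinset_Icc_part_rect.1 hμ
    rw [Finset.mem_Icc]
    omega
  · rw [Finset.mem_Icc] at hk
    refine mem_filter_piFinset_Icc_part_rect.2 ⟨fun j => ?_, ?_, ?_, ?_, ?_⟩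
    all_goals simp [part_replicate_append, part_cons] <;> omega
  · simp [part_replicate_append, part_cons]
  · rw [specializedSkewSchur_eq h (N := q + 2) _ (by simp)]
    congr 1
    ext j
    exact congrArg Nat.cast (congrFun (reconstruct μ hμ) j).symm

lemma specializedSkewSchur_singleton_eq_sum_take_drop (h : ℤ → R) {l : List ℕ} {N : ℕ}
    (hN : l.length = N + 1) (m : ℕ) :
    specializedSkewSchur h l [m] =
      ∑ a ∈ Finset.range (N + 1), (-1) ^ a * h (part l a - m - a) *
        specializedSkewSchur h ((l.take a).map (· + 1) ++ l.drop (a + 1)) [] := by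
  rw [specializedSkewSchur_eq h _ hN, jacobiTrudiDet_succ, ← Fin.sum_univ_eq_sum_range
    (fun a => (-1) ^ a * h (part l a - m - a) *
      specializedSkewSchur h ((l.take a).map (· + 1) ++ l.drop (a + 1)) [])]
  refine Finset.sum_congr rfl fun a _ => ?_
  have ha : (a : ℕ) < l.length := hN.symm ▸ a.2
  rw [specializedSkewSchur_eq h (N := N) _ (by simp; omega)]
  congr 2
  ext j
  rw [part_map_take_append_drop ha.le]
  simp [Fin.lt_def, apply_ite Nat.cast]

lemma specializedSkewSchur_rect_eq_sub_sum (h : ℤ → R) (p A B m : ℕ) :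
    specializedSkewSchur h (List.replicate p A ++ [B]) [m] =
      (-1) ^ p * (h (B - m - p) * specializedSkewSchur h (List.replicate p (A + 1)) [] -
        ∑ k ∈ Finset.range p, (-1) ^ k * h (A - m + 1 + k - p) *
          specializedSkewSchur h
            (List.replicate (p - k - 1) (A + 1) ++ List.replicate k A ++ [B]) []) := by
  rw [specializedSkewSchur_singleton_eq_sum_take_drop h (N := p) (by simp),
    Finset.sum_range_succ_comm, ← Finset.sum_range_reflect, mul_sub, sub_eq_add_neg _ (_ * _),
    Finset.mul_sum, ← Finset.sum_neg_distrib]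
  congr 1
  · simp [part_replicate_append, part_cons, List.drop_append, mul_assoc]
  · refine Finset.sum_congr rfl fun k hk => ?_
    obtain ⟨a, rfl⟩ : ∃ a, p = a + k + 1 :=
      ⟨p - k - 1, by have := Finset.mem_range.1 hk; omega⟩
    have row : a + k + 1 - 1 - k = a := by omega
    have index : (part (List.replicate (a + k + 1) A ++ [B]) a : ℤ) - m - a =
        A - m + 1 + k - (a + k + 1 : ℕ) := by
      rw [part_replicate_append, if_pos (by omega)]
      push_cast
      ring
    have sign : (-1 : R) ^ a = -((-1) ^ (a + k + 1) * (-1) ^ k) := by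
      rw [pow_succ, pow_add, mul_neg_one, neg_mul, neg_neg, mul_assoc, ← mul_pow]
      simp
    have shape : ((List.replicate (a + k + 1) A ++ [B]).take a).map (· + 1) ++
          (List.replicate (a + k + 1) A ++ [B]).drop (a + 1) =
        List.replicate (a + k + 1 - k - 1) (A + 1) ++ List.replicate k A ++ [B] := by
      rw [List.take_append_of_le_length (by simp; omega), List.take_replicate,
        min_eq_left (by omega), List.map_replicate,
        List.drop_append_of_le_length (by simp), List.drop_replicate, ← List.append_assoc]
      congr 3 <;> omega
    rw [row, index, sign, shape]
    ring

end Schur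

section Adjugate

lemma neg_one_pow_mul_pred {n : ℕ} (hn : n ≠ 0) (p : ℕ) :
    (-1 : R) ^ (p * (n - 1)) = (-1) ^ (n * p + p) := by
  obtain ⟨n, rfl⟩ := Nat.exists_eq_succ_of_ne_zero hn
  rw [Nat.succ_sub_one, show n.succ * p + p = p * n + 2 * p by rw [Nat.succ_mul]; ring, pow_add,
    pow_mul _ 2, neg_one_sq, one_pow, mul_one]

open PowerSeries in
lemma adjugate_toeplitzMatrix_mul_coeff {f g : R⟦X⟧} (hf : constantCoeff f = 1) (hfg : f * g = 1)
    (c : R) (p : ℕ) {n : ℕ} (i j : Fin n) :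
    (toeplitzMatrix n fun k => c * (f : R⸨X⸩).coeff (p - k)).adjugate i j =
      (-1) ^ (p * (n - 1)) * c ^ (n - 1) * specializedSkewSchur (g : R⸨X⸩).coeff
        (List.replicate p (n - 1) ++ [n - (i + 1)]) [n - (j + 1)] := by
  have smul_eq : (toeplitzMatrix n fun k => c * (f : R⸨X⸩).coeff (p - k)) =
      c • toeplitzMatrix n fun k => (f : R⸨X⸩).coeff (p - k) := by
    ext
    simp [toeplitzMatrix]
  rw [smul_eq, Matrix.adjugate_smul, Matrix.smul_apply, adjugate_toeplitzMatrix_coeff hf hfg,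
    specializedSkewSchur_eq (N := p + 1) _ _ (by simp), neg_one_pow_mul_pred i.pos.ne',
    Fintype.card_fin, smul_eq_mul, mul_left_comm, mul_assoc]
  have := i.pos
  congr 3
  all_goals
    ext a
    simp only [part_replicate_append, part_cons, part_nil]
    split_ifs <;> omega

end Adjugate

section GeneratingFunctions

open PowerSeries

/-- The generating series of the complete homogeneous symmetric polynomials, evaluated at `z`: the
inverse of `∏ (1 - z_j X)`. -/
noncomputable def hsymmSeries {σ : Type*} [Fintype σ] [DecidableEq σ] (z : σ → R) : R⟦X⟧ :=
  PowerSeries.mk fun k => MvPolynomial.eval z (MvPolynomial.hsymm σ R k)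

lemma hsymmSeries_eq_prod {σ : Type*} [Fintype σ] [DecidableEq σ] (z : σ → R) :
    hsymmSeries z = ∏ j, PowerSeries.mk fun k => z j ^ k := by
  ext n
  have mem_iff (P : σ →₀ ℕ) :
      P ∈ Finset.finsuppAntidiag Finset.univ n ↔ P.sum (fun _ => id) = n := by
    simp [Finset.mem_finsuppAntidiag, Finsupp.sum_fintype]
  rw [hsymmSeries, coeff_mk, coeff_prod, MvPolynomial.hsymm, map_sum]
  refine Finset.sum_bij (fun s _ => (Sym.equivNatSum σ n s : σ →₀ ℕ))
    (fun s _ => (mem_iff _).2 (Sym.equivNatSum σ n s).2)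
    (fun s _ t _ h => (Sym.equivNatSum σ n).injective (Subtype.ext h))
    (fun P hP => ⟨(Sym.equivNatSum σ n).symm ⟨P, (mem_iff P).1 hP⟩, Finset.mem_univ _, by simp⟩)
    fun s _ => ?_
  simp only [coeff_mk, Sym.coe_equivNatSum_apply_apply, map_multiset_prod, Multiset.map_map,
    Function.comp_apply, MvPolynomial.eval_X]
  rw [Finset.prod_multiset_map_count]
  exact Finset.prod_subset (Finset.subset_univ _) fun x _ hx => by
    rw [Multiset.count_eq_zero_of_notMem (by simpa using hx), pow_zero]

lemma one_sub_C_mul_X_mul_mk_pow (c : R) :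
    (1 - C c * X) * PowerSeries.mk (fun k => c ^ k) = 1 := by
  simpa [rescale_mk, rescale_X, mul_comm] using
    congrArg (rescale c) (mk_one_mul_one_sub_eq_one R)

lemma prod_one_sub_mul_hsymmSeries {σ : Type*} [Fintype σ] [DecidableEq σ] (z : σ → R) :
    (∏ j, (1 - C (z j) * X)) * hsymmSeries z = 1 := by
  rw [hsymmSeries_eq_prod, ← Finset.prod_mul_distrib]
  exact Finset.prod_eq_one fun j _ => one_sub_C_mul_X_mul_mk_pow _

lemma coeff_invert_toLaurent (q : Polynomial R) (k : ℤ) :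
    (LaurentPolynomial.invert (Polynomial.toLaurent q)).coeff (-k) =
      ((q : R⟦X⟧) : R⸨X⸩).coeff k := by
  rw [LaurentPolynomial.invert_apply, neg_neg, LaurentPolynomial.coeff_toLaurent]
  rcases lt_or_ge k 0 with hk | hk
  · rw [coeff_coe_of_neg _ hk, Finsupp.mapDomain_of_notMem_range]
    rintro ⟨m, hm⟩
    simp at hm
    omega
  · lift k to ℕ using hk
    rw [LaurentSeries.coeff_coe_powerSeries, Polynomial.coeff_coe]
    exact Finsupp.mapDomain_apply Nat.castEmbedding.injective _ _

lemma prod_T_sub_C {σ : Type*} [Fintype σ] (z : σ → R) :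
    ∏ j, (LaurentPolynomial.T 1 - LaurentPolynomial.C (z j) : R[T;T⁻¹]) =
      LaurentPolynomial.T (Fintype.card σ) * LaurentPolynomial.invert
        (Polynomial.toLaurent (∏ j, (1 - Polynomial.C (z j) * Polynomial.X))) := by
  have T_card : (LaurentPolynomial.T (Fintype.card σ) : R[T;T⁻¹]) =
      ∏ _j : σ, LaurentPolynomial.T 1 := by
    simp [LaurentPolynomial.T_pow]
  rw [T_card, map_prod, map_prod, ← Finset.prod_mul_distrib]
  refine Finset.prod_congr rfl fun j _ => ?_
  simp only [map_sub, map_one, map_mul, Polynomial.toLaurent_C, Polynomial.toLaurent_X,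
    LaurentPolynomial.invert_C, LaurentPolynomial.invert_T]
  rw [mul_sub, mul_one, mul_left_comm, ← LaurentPolynomial.T_add]
  simp

lemma coeff_C_mul_T_mul (c : R) (m : ℤ) (q : R[T;T⁻¹]) (k : ℤ) :
    (LaurentPolynomial.C c * LaurentPolynomial.T m * q).coeff k = c * q.coeff (k - m) := by
  rw [← LaurentPolynomial.single_eq_C_mul_T]
  exact AddMonoidAlgebra.coeff_single_mul_eq_mul_coeff _ fun m' _ => by omega

lemma coeff_C_mul_T_mul_prod_T_sub_C {σ : Type*} [Fintype σ] (c : R) (z : σ → R) (p k : ℤ) :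
    (LaurentPolynomial.C c * LaurentPolynomial.T (p - Fintype.card σ) *
      ∏ j, (LaurentPolynomial.T 1 - LaurentPolynomial.C (z j))).coeff k =
      c * ((∏ j, (1 - C (z j) * X) : R⟦X⟧) : R⸨X⸩).coeff (p - k) := by
  have coe_prod : ((∏ j, (1 - Polynomial.C (z j) * Polynomial.X) : Polynomial R) : R⟦X⟧) =
      ∏ j, (1 - C (z j) * X) := by
    rw [← Polynomial.coeToPowerSeries.ringHom_apply, map_prod]
    simp
  rw [prod_T_sub_C, ← mul_assoc, mul_assoc (LaurentPolynomial.C c), ← LaurentPolynomial.T_add,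
    sub_add_cancel, coeff_C_mul_T_mul, ← coe_prod, ← coeff_invert_toLaurent, neg_sub]

end GeneratingFunctions

section Evaluation

variable {w : ℕ} (z : Fin w → ℂ)

lemma eval_completeHomogeneous (k : ℤ) :
    MvPolynomial.eval z (completeHomogeneous w k) = (hsymmSeries z : ℂ⸨X⸩).coeff k := by
  rw [completeHomogeneous]
  split_ifs with hk
  · lift k to ℕ using hk
    rw [LaurentSeries.coeff_coe_powerSeries, hsymmSeries, PowerSeries.coeff_mk, Int.toNat_natCast]
  · rw [coeff_coe_of_neg _ (not_le.1 hk), map_zero]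

lemma eval_det_jacobiTrudi (l m : List ℕ) :
    MvPolynomial.eval z (jacobiTrudi w l m).det =
      specializedSkewSchur (hsymmSeries z : ℂ⸨X⸩).coeff l m := by
  rw [RingHom.map_det, specializedSkewSchur, jacobiTrudiDet]
  congr 1
  ext j k
  exact eval_completeHomogeneous z _

lemma eval_schur (l : List ℕ) :
    MvPolynomial.eval z (schur w l) = specializedSkewSchur (hsymmSeries z : ℂ⸨X⸩).coeff l [] := by
  rw [← eval_det_jacobiTrudi, schur, skewSchur,
    if_pos fun j => (part_nil j).trans_le (Nat.zero_le _)]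

lemma eval_skewSchur_singleton {l : List ℕ} (hl : l.Pairwise (· ≥ ·)) (hnil : l ≠ []) (m : ℕ) :
    MvPolynomial.eval z (skewSchur w l [m]) =
      specializedSkewSchur (hsymmSeries z : ℂ⸨X⸩).coeff l [m] := by
  rw [skewSchur]
  split_ifs with hml
  · exact eval_det_jacobiTrudi z l [m]
  · have hm : part l 0 < m := by
      by_contra! hm
      refine hml fun j => ?_
      rw [part_cons]
      split_ifs with hj
      · rwa [hj]
      · exact Nat.zero_le _
    have column_eq_zero (j : ℕ) : (hsymmSeries z : ℂ⸨X⸩).coeff (part l j - m - j) = 0 :=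
      coeff_coe_of_neg _ (by have := antitone_part hl j.zero_le; omega)
    rw [map_zero, specializedSkewSchur, jacobiTrudiDet]
    refine (det_eq_zero_of_column_eq_zero ⟨0, List.length_pos_of_ne_nil hnil⟩ fun j => ?_).symm
    simpa [part_cons] using column_eq_zero j

lemma toeplitz_eq_toeplitzMatrix {a : ℂ[T;T⁻¹]} {c : ℂ} {p : ℕ}
    (ha : a = LaurentPolynomial.C c * LaurentPolynomial.T ((p : ℤ) - (w : ℤ)) *
      ∏ j, (LaurentPolynomial.T 1 - LaurentPolynomial.C (z j))) (n : ℕ) :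
    toeplitz n a = toeplitzMatrix n fun k =>
      c * ((∏ j, (1 - PowerSeries.C (z j) * PowerSeries.X) : ℂ⟦X⟧) : ℂ⸨X⸩).coeff (p - k) := by
  ext j k
  simpa [ha, toeplitz, toeplitzMatrix] using
    coeff_C_mul_T_mul_prod_T_sub_C c z p ((j : ℤ) - (k : ℤ))

end Evaluation

end BandedToeplitz

open scoped PowerSeries LaurentSeries in
open BandedToeplitz PowerSeries in
theorem theorem2_general {R : Type*} [CommRing R] {f g : R⟦X⟧} (hf : constantCoeff f = 1)
    (hfg : f * g = 1) (c : R) (p : ℕ) {n : ℕ} (i j : Fin n) (r s : ℕ) (hr : r = (i : ℕ) + 1)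
    (hs : s = (j : ℕ) + 1) :
    ((toeplitzMatrix n fun k => c * (f : R⸨X⸩).coeff (p - k)).adjugate i j =
      (-1) ^ (p * (n - 1)) * c ^ (n - 1) *
        specializedSkewSchur (g : R⸨X⸩).coeff (List.replicate p (n - 1) ++ [s - 1]) [r - 1]) ∧
    ((toeplitzMatrix n fun k => c * (f : R⸨X⸩).coeff (p - k)).adjugate i j =
      (-1) ^ (p * (n - 1)) * c ^ (n - 1) *
        specializedSkewSchur (g : R⸨X⸩).coeff (List.replicate p (n - 1) ++ [n - r]) [n - s]) ∧
    (1 ≤ p →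
      (toeplitzMatrix n fun k => c * (f : R⸨X⸩).coeff (p - k)).adjugate i j =
        (-1) ^ (p * (n - 1)) * c ^ (n - 1) *
          ∑ k ∈ Finset.Icc (s - r) (min (n - r) (s - 1)),
            specializedSkewSchur (g : R⸨X⸩).coeff
              (List.replicate (p - 1) (n - 1) ++ [n + s - r - 1 - k, k]) []) ∧
    ((toeplitzMatrix n fun k => c * (f : R⸨X⸩).coeff (p - k)).adjugate i j =
      (-1) ^ (p * n) * c ^ (n - 1) *
        ((g : R⸨X⸩).coeff (s - r - p) *
          specializedSkewSchur (g : R⸨X⸩).coeff (List.replicate p n) [] -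
        ∑ k ∈ Finset.range p, (-1) ^ k * (g : R⸨X⸩).coeff (s + k - p) *
          specializedSkewSchur (g : R⸨X⸩).coeff
            (List.replicate (p - k - 1) n ++ List.replicate k (n - 1) ++ [n - r]) [])) := by
  have adjugate_eq := adjugate_toeplitzMatrix_mul_coeff hf hfg c p i j
  rw [← hr, ← hs] at adjugate_eq
  have reflect := specializedSkewSchur_rect_reflect (g : R⸨X⸩).coeff p
    (show n - r ≤ n - 1 by omega) (show n - s ≤ n - 1 by omega)
  rw [show n - 1 - (n - s) = s - 1 by omega, show n - 1 - (n - r) = r - 1 by omega] at reflect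
  refine ⟨reflect ▸ adjugate_eq, adjugate_eq, fun hp => ?_, ?_⟩
  · obtain ⟨q, rfl⟩ := Nat.exists_eq_add_of_le' hp
    rw [adjugate_eq, reflect, specializedSkewSchur_rect_eq_sum (fun k => coeff_coe_of_neg g) q
      (by omega) (by omega), show s - 1 - (r - 1) = s - r by omega,
      show n - 1 - (r - 1) = n - r by omega,
      show n - 1 + (s - 1) - (r - 1) = n + s - r - 1 by omega, Nat.add_sub_cancel]
  · have sign : (-1 : R) ^ (p * (n - 1)) * (-1) ^ p = (-1) ^ (p * n) := by
      rw [← pow_add, ← Nat.mul_succ, Nat.succ_eq_add_one, Nat.sub_add_cancel i.pos]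
    rw [adjugate_eq, specializedSkewSchur_rect_eq_sub_sum, ← sign,
      show ((n - r : ℕ) : ℤ) - (n - s : ℕ) - p = s - r - p by omega, Nat.sub_add_cancel i.pos,
      show ((n - 1 : ℕ) : ℤ) - (n - s : ℕ) + 1 = s by omega]
    ring

theorem theorem2 (p w n : ℕ) (hw : 1 ≤ w) (hn : 1 ≤ n)
    (a : ℂ[T;T⁻¹]) (z : Fin w → ℂ) (hap : a.coeff (p : ℤ) ≠ 0)
    (ha : a = LaurentPolynomial.C (a.coeff (p : ℤ)) * LaurentPolynomial.T ((p : ℤ) - (w : ℤ)) *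
      ∏ j : Fin w, (LaurentPolynomial.T 1 - LaurentPolynomial.C (z j)))
    -- the row `r` and the column `s` are counted from `1`
    (i j : Fin n) (r s : ℕ) (hr : r = (i : ℕ) + 1) (hs : s = (j : ℕ) + 1) :
    ((BandedToeplitz.toeplitz n a).adjugate i j =
      (-1) ^ (p * (n - 1)) * a.coeff (p : ℤ) ^ (n - 1) *
        MvPolynomial.eval z
          (BandedToeplitz.skewSchur w (List.replicate p (n - 1) ++ [s - 1]) [r - 1])) ∧
    ((BandedToeplitz.toeplitz n a).adjugate i j =
      (-1) ^ (p * (n - 1)) * a.coeff (p : ℤ) ^ (n - 1) *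
        MvPolynomial.eval z
          (BandedToeplitz.skewSchur w (List.replicate p (n - 1) ++ [n - r]) [n - s])) ∧
    (1 ≤ p →
      (BandedToeplitz.toeplitz n a).adjugate i j =
        (-1) ^ (p * (n - 1)) * a.coeff (p : ℤ) ^ (n - 1) *
          ∑ k ∈ Finset.Icc (s - r) (min (n - r) (s - 1)),
            MvPolynomial.eval z
              (BandedToeplitz.schur w
                (List.replicate (p - 1) (n - 1) ++ [n + s - r - 1 - k, k]))) ∧
    ((BandedToeplitz.toeplitz n a).adjugate i j =
      (-1) ^ (p * n) * a.coeff (p : ℤ) ^ (n - 1) *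
        (MvPolynomial.eval z
            (BandedToeplitz.completeHomogeneous w ((s : ℤ) - (r : ℤ) - (p : ℤ))) *
          MvPolynomial.eval z (BandedToeplitz.schur w (List.replicate p n)) -
        ∑ k ∈ Finset.range p,
          (-1) ^ k *
            MvPolynomial.eval z
              (BandedToeplitz.completeHomogeneous w ((s : ℤ) + (k : ℤ) - (p : ℤ))) *
            MvPolynomial.eval z
              (BandedToeplitz.schur w
                (List.replicate (p - k - 1) n ++ List.replicate k (n - 1) ++ [n - r])))) := by
  have rect {B : ℕ} (hB : B ≤ n - 1) := BandedToeplitz.eval_skewSchur_singleton z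
    (BandedToeplitz.pairwise_replicate_append_singleton hB p) (by simp)
  rw [BandedToeplitz.toeplitz_eq_toeplitzMatrix z ha, rect (by omega), rect (by omega)]
  simp only [BandedToeplitz.eval_schur, BandedToeplitz.eval_completeHomogeneous]
  exact theorem2_general (by simp) (BandedToeplitz.prod_one_sub_mul_hsymmSeries z) _ p i j r s hr hs
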